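/- Let $F:\mathbb{R}^d\to\mathbb{R}$ be a convex differentiable function with a (possibly non-unique) minimizer $x^*$, let $\alpha\in(\frac12,1)$, $G>0$ and $x_0\in\mathbb{R}^d$, and let $\|\cdot\|$ be the Euclidean norm. Put $\eta_t=\frac{1}{G\,t^{\alpha}}$ for $t\ge 1$. Consider FTRL with rescaled gradients and linearithmic regularizer: start with $S_0^2=4$, $Q_0=0$, $\theta_0=0$, and in each round $t=1,2,\dots$ output $$x_t=x_0+\begin{cases}\dfrac{\theta_{t-1}}{2S_{t-1}^2}\exp\!\left(\dfrac{\|\theta_{t-1}\|^2}{4S_{t-1}^2}-Q_{t-1}\right)&\text{if }\|\theta_{t-1}\|\le S_{t-1}^2,\\[2mm]\dfrac{\theta_{t-1}}{2\|\theta_{t-1}\|}\exp\!\left(\dfrac{\|\theta_{t-1}\|}{2}-\dfrac14S_{t-1}^2-Q_{t-1}\right)&\text{if }\|\theta_{t-1}\|>S_{t-1}^2,\end{cases}$$ receive a random vector $g_t\in\mathbb{R}^d$, set $\ell_t=\eta_t g_t$, and update $S_t^2=S_{t-1}^2+\|\ell_t\|^2$, $Q_t=Q_{t-1}+\|\ell_t\|^2/S_t^2$,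 $\theta_t=\theta_{t-1}-\ell_t$. Suppose that for every $t\ge1$ the stochastic gradient satisfies $\mathbb{E}[g_t\mid\mathcal{F}_t]=\nabla F(x_t)$ and $\|g_t\|\le G$ almost surely, where $\mathcal{F}_t$ is the $\sigma$-algebra generated by $x_1,\dots,x_t,g_1,\dots,g_{t-1}$. Then for every $T\ge1$ the random variable $F(x_T)$ is integrable and $$\mathbb{E}[F(x_T)]-F(x^*)\le\frac{G}{T^{1-\alpha}}\left(2+\frac{1}{e(2\alpha-1)}\right)\Bigl(\exp(S)+3\|x^*-x_0\|+6(S+2)\bigl(2+S\|x^*-x_0\|\,[\,2\ln(1+2\|x^*-x_0\|)+9S\,]\bigr)\Bigr),$$ where $S=\sqrt{5+\frac{1}{2\alpha-1}}$ and $e=2.718\dots$ is Euler's number. -/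

import Mathlib

open MeasureTheory

noncomputable section

namespace FTRL

/-- The internal state kept by the algorithm after a round `t`: the negative sum `θ = θ_t` of
the rescaled gradients, the number `Ssq = S_t ^ 2`, and the number `Q = Q_t`. -/
structure State (d : ℕ) where
  θ : EuclideanSpace ℝ (Fin d)
  Ssq : ℝ
  Q : ℝ

/-- Initial state: `θ_0 = 0`, `S_0 ^ 2 = 4`, `Q_0 = 0`. -/
def State.init (d : ℕ) : State d := ⟨0, 4, 0⟩

/-- Update with a rescaled gradient `ℓ = ℓ_t`: `θ_t = θ_{t-1} - ℓ_t`,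
`S_t ^ 2 = S_{t-1} ^ 2 + ‖ℓ_t‖ ^ 2` and `Q_t = Q_{t-1} + ‖ℓ_t‖ ^ 2 / S_t ^ 2`. -/
def State.step {d : ℕ} (s : State d) (ℓ : EuclideanSpace ℝ (Fin d)) : State d where
  θ := s.θ - ℓ
  Ssq := s.Ssq + ‖ℓ‖ ^ 2
  Q := s.Q + ‖ℓ‖ ^ 2 / (s.Ssq + ‖ℓ‖ ^ 2)

/-- The point output from a given state by the algorithm started at `x₀`. -/
def State.output {d : ℕ} (x₀ : EuclideanSpace ℝ (Fin d)) (s : State d) :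
    EuclideanSpace ℝ (Fin d) :=
  x₀ + if ‖s.θ‖ ≤ s.Ssq then
      Real.exp (‖s.θ‖ ^ 2 / (4 * s.Ssq) - s.Q) • ((1 / (2 * s.Ssq)) • s.θ)
    else
      Real.exp (‖s.θ‖ / 2 - s.Ssq / 4 - s.Q) • ((1 / (2 * ‖s.θ‖)) • s.θ)

/-- State after `t` rounds, for learning rates `η 1, η 2, …` and gradients `g 1, g 2, …`. -/
def state {d : ℕ} (η : ℕ → ℝ) (g : ℕ → EuclideanSpace ℝ (Fin d)) : ℕ → State d
  | 0 => State.init d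
  | t + 1 => (state η g t).step (η (t + 1) • g (t + 1))

/-- The iterates of FTRL with rescaled gradients and linearithmic regularizer: the value at `0`
is the initial point, and for `t ≥ 1` the iterate `x_t` is output from the state after `t - 1`
rounds. -/
def iterate {d : ℕ} (x₀ : EuclideanSpace ℝ (Fin d)) (η : ℕ → ℝ)
    (g : ℕ → EuclideanSpace ℝ (Fin d)) : ℕ → EuclideanSpace ℝ (Fin d)
  | 0 => x₀
  | t + 1 => (state η g t).output x₀

/-- The σ-algebra `ℱ_t` generated by `x_1, …, x_t, g_1, …, g_{t-1}`. -/
abbrev history {Ω : Type*} {d : ℕ} (x g : ℕ → Ω → EuclideanSpace ℝ (Fin d)) (t : ℕ) :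
    MeasurableSpace Ω :=
  (⨆ i ∈ Set.Icc 1 t, MeasurableSpace.comap (x i) inferInstance) ⊔
    (⨆ i ∈ Set.Ico 1 t, MeasurableSpace.comap (g i) inferInstance)

end FTRL

end

/-! The displacement `x_{t+1} - x₀` is the gradient at `θ_t` of the convex potential `Φ_t(v) = exp
(huber S_t² ‖v‖ - Q_t)`. One round satisfies `Φ_t(θ_t) ≤ Φ_{t-1}(θ_{t-1}) - ⟪ℓ_t, x_t - x₀⟫`
(`State.potential_step_le`), the growth of `S_t²` and `Q_t` paying for the second-order term.
Telescoping gives two pathwise regret bounds.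

Against `x*`, the exponential left in `Φ_n(θ_n)` dominates `‖θ_n‖ ‖x* - x₀‖` up to a constant and
also controls `‖x_{n+1} - x₀‖` (`norm_add_sum_inner_le`). Hence the expected distance of every
iterate from `x₀` is bounded.

Against an earlier iterate `x_s`, the tangent inequality for `Φ_{s-1}` is transported to later
potentials, which cost little more than a shift of the point (`State.exists_potential_le_step`). The
regret from `s` on is then at most `(‖x_s - x₀‖ + 1/4) ∑ ‖ℓ_t‖²` (`sum_inner_sub_iterate_le`).

Convexity and conditional expectation turn both bounds into statements about `q_t = E F(x_t) -
F(x*)`. Comparing averages over the suffixes `s, …, T` isolates `q_T` (`last_iterate_le`). Since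
`‖ℓ_t‖² ≤ t^(-2α)`, the weighted tails sum to order `1 + T^(1-2α) log T`, which is bounded
(`mul_sum_weighted_tail_le`). -/

namespace FTRL

open Real

/-! ### Scalar inequalities for the exponent -/

/-- The Huber-type function whose exponential gives the potential of the algorithm. -/
noncomputable def huber (A r : ℝ) : ℝ := if r ≤ A then r ^ 2 / (4 * A) else r / 2 - A / 4

lemma huber_le_quadratic {A : ℝ} (hA : 0 < A) (r : ℝ) : huber A r ≤ r ^ 2 / (4 * A) := by
  unfold huber
  split_ifs with h
  · exact le_rfl
  · rw [le_div_iff₀ (by positivity)]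
    nlinarith [sq_nonneg (r - A)]

lemma linear_le_huber {A : ℝ} (hA : 0 < A) (r : ℝ) : r / 2 - A / 4 ≤ huber A r := by
  unfold huber
  split_ifs with h
  · rw [le_div_iff₀ (by positivity)]
    nlinarith [sq_nonneg (r - A)]
  · exact le_rfl

lemma huber_of_ge {A r : ℝ} (hA : 0 < A) (h : A ≤ r) : huber A r = r / 2 - A / 4 := by
  unfold huber
  split_ifs with h'
  · obtain rfl : r = A := le_antisymm h' h
    field_simp
    ring
  · rfl

lemma huber_le_half {A r : ℝ} (hA : 0 < A) (hr : 0 ≤ r) : huber A r ≤ r / 2 := by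
  unfold huber
  split_ifs with h
  · rw [div_le_iff₀ (by positivity)]
    nlinarith
  · linarith

/-- The derivative of `huber A` divided by `r`, which is the weight used by the output. -/
noncomputable def huberWeight (A r : ℝ) : ℝ := if r ≤ A then 1 / (2 * A) else 1 / (2 * r)

lemma huberWeight_nonneg {A r : ℝ} (hA : 0 < A) : 0 ≤ huberWeight A r := by
  unfold huberWeight
  split_ifs with h
  · positivity
  · have : 0 < r := by linarith
    positivity

lemma huberWeight_mul_le {A r : ℝ} (hA : 0 < A) : huberWeight A r * r ≤ 1 / 2 := by
  unfold huberWeight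
  split_ifs with h
  · rw [div_mul_eq_mul_div, div_le_iff₀ (by positivity)]
    linarith
  · have : 0 < r := by linarith
    apply le_of_eq
    field_simp

/-- `huber A` lies above its tangents. -/
lemma huber_tangent {A r r' : ℝ} (hA : 0 < A) :
    huber A r + huberWeight A r * r * (r' - r) ≤ huber A r' := by
  by_cases h : r ≤ A
  · by_cases h' : r' ≤ A
    · simp only [huber, huberWeight, h, h', if_true]
      rw [← sub_nonneg]
      have : r' ^ 2 / (4 * A) - (r ^ 2 / (4 * A) + 1 / (2 * A) * r * (r' - r))
          = (r' - r) ^ 2 / (4 * A) := by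
        field_simp
        ring
      rw [this]
      positivity
    · simp only [huber, huberWeight, h, h', if_true, if_false]
      rw [← sub_nonneg]
      have : r' / 2 - A / 4 - (r ^ 2 / (4 * A) + 1 / (2 * A) * r * (r' - r))
          = (A - r) * (2 * r' - A - r) / (4 * A) := by
        field_simp
        ring
      rw [this]
      push Not at h'
      have : 0 ≤ (A - r) * (2 * r' - A - r) := mul_nonneg (by linarith) (by linarith)
      positivity
  · have h0 : 0 < r := by linarith
    have := linear_le_huber hA r'
    simp only [huberWeight, h, if_false]
    rw [huber_of_ge hA (by linarith)]
    have e : 1 / (2 * r) * r = 1 / 2 := by field_simp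
    rw [e]
    linarith

/-- This converts a drop of `z + z ^ 2` in the exponent into a linear drop of the potential. For `z
≥ 0` the quadratic lower bound for `exp` reduces it to `2 z ≤ (1 - z) (1 + z)²`; for `z ≤ 0` the
error `w ^ 2` of `exp w ≈ 1 + w` at `w = -z - z ^ 2` is at most `z ^ 2`. -/
lemma exp_neg_sub_sq_le {z : ℝ} (h1 : -(1 / 2) ≤ z) (h2 : z ≤ 1 / 2) :
    exp (-z - z ^ 2) ≤ 1 - z := by
  rcases le_total 0 z with hz | hz
  · have h : 1 + (z + z ^ 2) + (z + z ^ 2) ^ 2 / 2 ≤ exp (z + z ^ 2) :=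
      quadratic_le_exp_of_nonneg (by positivity)
    have e : exp (-z - z ^ 2) = (exp (z + z ^ 2))⁻¹ := by rw [← exp_neg]; ring_nf
    rw [e, inv_le_comm₀ (exp_pos _) (by linarith)]
    refine le_trans ?_ h
    rw [inv_le_iff_one_le_mul₀ (by linarith)]
    have : 0 ≤ z ^ 2 * ((1 - z) * (1 + z) ^ 2 - 2 * z) := by
      apply mul_nonneg (sq_nonneg z)
      nlinarith [mul_nonneg hz (sub_nonneg.2 h2), mul_nonneg (mul_nonneg hz hz) (sub_nonneg.2 h2)]
    nlinarith
  · have h := abs_exp_sub_one_sub_id_le (x := -z - z ^ 2)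
      (abs_le.2 ⟨by nlinarith, by nlinarith⟩)
    have h' := (abs_le.1 h).2
    have : (-z - z ^ 2) ^ 2 ≤ z ^ 2 := by
      rw [sq_le_sq]
      rw [abs_of_nonneg (by nlinarith), abs_of_nonpos hz]
      nlinarith
    linarith

/-- One-step inequality for `huber`, in terms of `r = ‖θ‖`, `ρ = ‖θ - ℓ‖`, `n = ‖ℓ‖` and
`p = ⟪ℓ, θ⟫`. -/
lemma huber_step {A r ρ n p : ℝ} (hA : 4 ≤ A) (hr : 0 ≤ r) (hρ : 0 ≤ ρ) (hn : 0 ≤ n)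
    (hn1 : n ≤ 1) (hp : |p| ≤ r * n) (h : ρ ^ 2 = r ^ 2 - 2 * p + n ^ 2) :
    huber (A + n ^ 2) ρ - n ^ 2 / (A + n ^ 2) ≤
      huber A r - huberWeight A r * p - (huberWeight A r * p) ^ 2 := by
  have hA0 : 0 < A := by linarith
  obtain ⟨hp1, hp2⟩ := abs_le.1 hp
  have hpsq : p ^ 2 ≤ r ^ 2 * n ^ 2 := by
    rw [← mul_pow]
    exact sq_le_sq' hp1 hp2
  have hnn : n ^ 2 ≤ 1 := by nlinarith
  set a := n ^ 2 with ha
  have ha0 : 0 ≤ a := by positivity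
  have hB : 0 < A + a := by positivity
  by_cases hrA : r ≤ A
  · have hq := huber_le_quadratic hB ρ
    simp only [huber, huberWeight, hrA, if_true] at hq ⊢
    refine le_trans (sub_le_sub_right hq _) ?_
    rw [h, ← sub_nonneg]
    have e : r ^ 2 / (4 * A) - 1 / (2 * A) * p - (1 / (2 * A) * p) ^ 2 -
        ((r ^ 2 - 2 * p + a) / (4 * (A + a)) - a / (A + a)) =
        ((r ^ 2 * a - p ^ 2) * A + a * (3 * A ^ 2 - 2 * p * A - p ^ 2)) / (4 * A ^ 2 * (A + a)) := by
      field_simp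
      ring
    rw [e]
    have hpA : p ≤ A := by nlinarith
    have hpA' : -A ≤ p := by nlinarith
    have : 0 ≤ (A - p) * (3 * A + p) := mul_nonneg (by linarith) (by linarith)
    have h3 : 0 ≤ a * (3 * A ^ 2 - 2 * p * A - p ^ 2) := mul_nonneg ha0 (by nlinarith)
    have h4 : 0 ≤ (r ^ 2 * a - p ^ 2) * A := mul_nonneg (by linarith) hA0.le
    positivity
  · push Not at hrA
    have hr0 : 0 < r := by linarith
    -- `c` is the component of `ℓ` along `θ`, so `ρ ^ 2 = (r - c) ^ 2 + (a - c ^ 2)`.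
    obtain ⟨c, rfl⟩ : ∃ c, p = c * r := ⟨p / r, by field_simp⟩
    have hcn : c ≤ n := by nlinarith
    have hcn' : -n ≤ c := by nlinarith
    have hc2 : c ^ 2 ≤ a := by nlinarith
    rw [huber_of_ge hA0 hrA.le]
    have ew : huberWeight A r * (c * r) = c / 2 := by
      simp only [huberWeight, not_le.2 hrA, if_false]
      field_simp
    rw [ew]
    by_cases hρB : ρ ≤ A + a
    · simp only [huber, hρB, if_true]
      rw [h, ← sub_nonneg]
      have e : r / 2 - A / 4 - c / 2 - (c / 2) ^ 2 -
          ((r ^ 2 - 2 * (c * r) + a) / (4 * (A + a)) - a / (A + a)) =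
          (-(A + a - r + c) ^ 2 + (a - c ^ 2) * (A + a) + c ^ 2 + 3 * a) / (4 * (A + a)) := by
        field_simp
        ring
      rw [e]
      have hlow : 0 ≤ A + a - r + c := by
        have : r - c ≤ ρ := by
          apply le_of_abs_le; apply abs_le_of_sq_le_sq _ hρ
          nlinarith
        linarith
      have hup : A + a - r + c ≤ a + c := by linarith
      have : (A + a - r + c) ^ 2 ≤ (a + c) ^ 2 := by gcongr
      have h5 : c ^ 2 ≤ (a - c ^ 2) * (A + a) + c ^ 2 := by
        have := mul_nonneg (sub_nonneg.2 hc2) hB.le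
        linarith
      have h6 : a * (a + 2 * c) ≤ a * 3 := by
        apply mul_le_mul_of_nonneg_left _ ha0
        linarith
      apply div_nonneg _ (by positivity)
      nlinarith
    · push Not at hρB
      rw [huber_of_ge hB hρB.le]
      -- The norm is expanded to second order. The error `a / (4 r)` after halving is absorbed by
      -- the increment of `Q`, and `(c / 2) ^ 2 ≤ a / 4` by the growth of `A`.
      have hρr : ρ ≤ r - c + a / (2 * r) := by
        have hpos : 0 ≤ r - c + a / (2 * r) := by
          have : 0 ≤ a / (2 * r) := by positivity
          linarith
        apply le_of_abs_le; apply abs_le_of_sq_le_sq _ hpos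
        have e : (r - c + a / (2 * r)) ^ 2 =
            r ^ 2 - 2 * (c * r) + a + (c - a / (2 * r)) ^ 2 := by
          field_simp
          ring
        rw [e, h]
        nlinarith [sq_nonneg (c - a / (2 * r))]
      have h7 : a / (4 * r) ≤ a / (A + a) := by
        apply div_le_div_of_nonneg_left ha0 hB
        linarith
      have h8 : a / (2 * r) / 2 = a / (4 * r) := by field_simp; norm_num
      nlinarith

/-! ### The potential: one-step decrease, tangents, stability -/

section Potential

variable {d : ℕ}

/-- The potential, whose gradient at `s.θ` is the displacement of the output. -/
noncomputable def State.potential (s : State d) (v : EuclideanSpace ℝ (Fin d)) : ℝ :=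
  exp (huber s.Ssq ‖v‖ - s.Q)

lemma State.potential_pos (s : State d) (v : EuclideanSpace ℝ (Fin d)) : 0 < s.potential v :=
  exp_pos _

lemma State.output_sub (x₀ : EuclideanSpace ℝ (Fin d)) (s : State d) :
    s.output x₀ - x₀ = (s.potential s.θ * huberWeight s.Ssq ‖s.θ‖) • s.θ := by
  unfold State.output State.potential huber huberWeight
  split_ifs with h <;> simp [smul_smul]

lemma State.norm_output_sub_le (x₀ : EuclideanSpace ℝ (Fin d)) (s : State d) (hs : 0 < s.Ssq) :
    ‖s.output x₀ - x₀‖ ≤ s.potential s.θ / 2 := by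
  rw [s.output_sub, norm_smul, Real.norm_eq_abs,
    abs_of_nonneg (mul_nonneg (s.potential_pos _).le (huberWeight_nonneg hs)), mul_assoc]
  have := mul_le_mul_of_nonneg_left (huberWeight_mul_le (r := ‖s.θ‖) hs) (s.potential_pos s.θ).le
  linarith

/-- With `z = w * p`, `huber_step` lowers the exponent by `z + z ^ 2`, and `|z| ≤ 1 / 2` because the
exponent has slope at most `1 / 2` in the norm and `‖ℓ‖ ≤ 1`. -/
lemma State.potential_step_le (x₀ : EuclideanSpace ℝ (Fin d)) (s : State d) (hs : 4 ≤ s.Ssq)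
    (ℓ : EuclideanSpace ℝ (Fin d)) (hℓ : ‖ℓ‖ ≤ 1) :
    (s.step ℓ).potential (s.step ℓ).θ ≤
      s.potential s.θ - inner ℝ ℓ (s.output x₀ - x₀) := by
  have hs0 : 0 < s.Ssq := by linarith
  have hp : |inner ℝ ℓ s.θ| ≤ ‖s.θ‖ * ‖ℓ‖ := by
    rw [mul_comm]
    exact abs_real_inner_le_norm _ _
  have hsq : ‖s.θ - ℓ‖ ^ 2 = ‖s.θ‖ ^ 2 - 2 * inner ℝ ℓ s.θ + ‖ℓ‖ ^ 2 := by
    rw [norm_sub_sq_real, real_inner_comm]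
  have key := huber_step hs (norm_nonneg s.θ) (norm_nonneg (s.θ - ℓ)) (norm_nonneg ℓ) hℓ hp hsq
  rw [s.output_sub, inner_smul_right]
  set w := huberWeight s.Ssq ‖s.θ‖
  set p : ℝ := inner ℝ ℓ s.θ
  have hw : 0 ≤ w := huberWeight_nonneg hs0
  have hwp : |w * p| ≤ 1 / 2 := by
    rw [abs_mul, abs_of_nonneg hw]
    calc w * |p| ≤ w * (‖s.θ‖ * ‖ℓ‖) := by gcongr
      _ ≤ w * (‖s.θ‖ * 1) := by gcongr
      _ ≤ 1 / 2 := by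
        rw [mul_one]
        exact huberWeight_mul_le hs0
  have hexp := exp_neg_sub_sq_le (abs_le.1 hwp).1 (abs_le.1 hwp).2
  calc (s.step ℓ).potential (s.step ℓ).θ
      = exp (huber (s.Ssq + ‖ℓ‖ ^ 2) ‖s.θ - ℓ‖ - ‖ℓ‖ ^ 2 / (s.Ssq + ‖ℓ‖ ^ 2) - s.Q) := by
        simp only [State.potential, State.step]
        congr 1
        ring
    _ ≤ exp (huber s.Ssq ‖s.θ‖ - w * p - (w * p) ^ 2 - s.Q) := by gcongr
    _ = s.potential s.θ * exp (-(w * p) - (w * p) ^ 2) := by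
        rw [State.potential, ← exp_add]
        congr 1
        ring
    _ ≤ s.potential s.θ * (1 - w * p) := by
        gcongr
        exact (s.potential_pos _).le
    _ = _ := by ring

lemma State.potential_tangent (x₀ : EuclideanSpace ℝ (Fin d)) (s : State d) (hs : 0 < s.Ssq)
    (v : EuclideanSpace ℝ (Fin d)) :
    s.potential s.θ + inner ℝ (s.output x₀ - x₀) (v - s.θ) ≤ s.potential v := by
  have hin : inner ℝ s.θ (v - s.θ) ≤ ‖s.θ‖ * (‖v‖ - ‖s.θ‖) := by
    rw [inner_sub_right, real_inner_self_eq_norm_sq]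
    have := real_inner_le_norm s.θ v
    nlinarith
  have hw : 0 ≤ huberWeight s.Ssq ‖s.θ‖ := huberWeight_nonneg hs
  have ht := huber_tangent (r := ‖s.θ‖) (r' := ‖v‖) hs
  rw [s.output_sub, inner_smul_left]
  simp only [conj_trivial]
  have hP := s.potential_pos s.θ
  have e : s.potential v = s.potential s.θ * exp (huber s.Ssq ‖v‖ - huber s.Ssq ‖s.θ‖) := by
    rw [State.potential, State.potential, ← exp_add]
    congr 1
    ring
  rw [e]
  have h1 := add_one_le_exp (huber s.Ssq ‖v‖ - huber s.Ssq ‖s.θ‖)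
  have h2 := mul_le_mul_of_nonneg_left hin hw
  calc _ = s.potential s.θ * (1 + huberWeight s.Ssq ‖s.θ‖ * inner ℝ s.θ (v - s.θ)) := by ring
    _ ≤ _ := by
      gcongr
      linarith

/-- A step decreases the potential at a point by little more than moving the point towards the
origin by at most `‖ℓ‖ ^ 2`. -/
lemma State.exists_potential_le_step (s : State d) (hs : 4 ≤ s.Ssq) (hQ : 0 ≤ s.Q)
    (ℓ : EuclideanSpace ℝ (Fin d)) (v : EuclideanSpace ℝ (Fin d)) :
    ∃ v', ‖v - v'‖ ≤ ‖ℓ‖ ^ 2 ∧ s.potential v' ≤ (s.step ℓ).potential v + ‖ℓ‖ ^ 2 / 4 := by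
  simp only [State.potential, State.step]
  set a := ‖ℓ‖ ^ 2
  have ha : 0 ≤ a := by positivity
  have hA : 0 < s.Ssq := by linarith
  have hB : 0 < s.Ssq + a := by positivity
  by_cases h : ‖v‖ ≤ s.Ssq + a
  -- In the quadratic region, scaling `v` by the ratio `c` of the two parameters multiplies the
  -- exponent by `c`. Convexity of `exp` between `0` and `y` then leaves an excess of `1 - c ≤ a /
  -- 4`, and the factor `c` is covered by the increment of `Q`.
  · set c := s.Ssq / (s.Ssq + a) with hc
    have hc0 : 0 ≤ c := by positivity
    have hc1 : 1 - c = a / (s.Ssq + a) := by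
      rw [hc]
      field_simp
      ring
    have hc1' : 0 ≤ 1 - c := by
      rw [hc1]
      positivity
    refine ⟨c • v, ?_, ?_⟩
    · have : v - c • v = (1 - c) • v := by rw [sub_smul, one_smul]
      rw [this, norm_smul, Real.norm_eq_abs, abs_of_nonneg hc1', hc1,
        div_mul_eq_mul_div, div_le_iff₀ hB]
      gcongr
    · set y := huber (s.Ssq + a) ‖v‖ with hy
      have hle : huber s.Ssq ‖c • v‖ ≤ c * y := by
        refine (huber_le_quadratic hA _).trans (le_of_eq ?_)
        rw [hy, norm_smul, Real.norm_eq_abs, abs_of_nonneg hc0, hc]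
        simp only [huber, h, if_true]
        field_simp
      have hconv : exp (c * y) ≤ c * exp y + (1 - c) := by
        have := convexOn_exp.2 (Set.mem_univ y) (Set.mem_univ 0) hc0 hc1' (by ring)
        simpa using this
      have hcexp : c ≤ exp (-(a / (s.Ssq + a))) := by
        have := add_one_le_exp (-(a / (s.Ssq + a)))
        linarith
      have hQ1 : exp (-s.Q) ≤ 1 := by
        rw [exp_le_one_iff]
        linarith
      have h14 : 1 - c ≤ a / 4 := by
        rw [hc1]
        gcongr
        linarith
      calc exp (huber s.Ssq ‖c • v‖ - s.Q) ≤ exp (c * y - s.Q) := by gcongr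
        _ = exp (c * y) * exp (-s.Q) := by rw [← exp_add, sub_eq_add_neg]
        _ ≤ (c * exp y + (1 - c)) * exp (-s.Q) := by gcongr
        _ = c * (exp y * exp (-s.Q)) + (1 - c) * exp (-s.Q) := by ring
        _ ≤ exp (-(a / (s.Ssq + a))) * (exp y * exp (-s.Q)) + (1 - c) * 1 := by gcongr
        _ ≤ _ := by
          rw [← exp_add, ← exp_add, mul_one]
          have : -(a / (s.Ssq + a)) + (y + -s.Q) = y - (s.Q + a / (s.Ssq + a)) := by ring
          rw [this]
          linarith
  · push Not at h
    have hv : 0 < ‖v‖ := by linarith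
    -- In the linear region, shortening `v` by `a` lowers the exponent by `a / 2`; passing to the
    -- new parameter and `Q` lowers it by only `a / 4 + a / (s.Ssq + a) ≤ a / 2`.
    refine ⟨(1 - a / ‖v‖) • v, ?_, ?_⟩
    · have : v - (1 - a / ‖v‖) • v = (a / ‖v‖) • v := by
        rw [sub_smul, one_smul]
        abel
      rw [this, norm_smul, Real.norm_eq_abs, abs_of_nonneg (by positivity)]
      apply le_of_eq
      field_simp
    · have hn : ‖(1 - a / ‖v‖) • v‖ = ‖v‖ - a := by
        rw [norm_smul, Real.norm_eq_abs, abs_of_nonneg]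
        · field_simp
        · rw [sub_nonneg, div_le_one hv]
          linarith
      rw [hn, huber_of_ge hA (by linarith), huber_of_ge hB h.le]
      have : a / (s.Ssq + a) ≤ a / 4 := by
        gcongr
        linarith
      calc _ ≤ exp (‖v‖ / 2 - (s.Ssq + a) / 4 - (s.Q + a / (s.Ssq + a))) := by
            rw [exp_le_exp]
            linarith
        _ ≤ _ := by
            have : 0 ≤ a / 4 := by positivity
            linarith

end Potential

/-! ### Pathwise regret bounds -/

section Path

variable {d : ℕ} (η : ℕ → ℝ) (g : ℕ → EuclideanSpace ℝ (Fin d))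

lemma state_Ssq (n : ℕ) :
    (state η g n).Ssq = 4 + ∑ t ∈ Finset.Ico 1 (n + 1), ‖η t • g t‖ ^ 2 := by
  induction n with
  | zero => simp [state, State.init]
  | succ n ih =>
    rw [Finset.sum_Ico_succ_top (by omega), ← add_assoc, ← ih]
    rfl

lemma state_θ (n : ℕ) :
    (state η g n).θ = -∑ t ∈ Finset.Ico 1 (n + 1), η t • g t := by
  induction n with
  | zero => simp [state, State.init]
  | succ n ih =>
    rw [Finset.sum_Ico_succ_top (by omega), neg_add, ← ih, ← sub_eq_add_neg]
    rfl

lemma four_le_Ssq (n : ℕ) : 4 ≤ (state η g n).Ssq := by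
  rw [state_Ssq]
  have : 0 ≤ ∑ t ∈ Finset.Ico 1 (n + 1), ‖η t • g t‖ ^ 2 :=
    Finset.sum_nonneg fun _ _ => by positivity
  linarith

lemma state_Q_nonneg (n : ℕ) : 0 ≤ (state η g n).Q := by
  induction n with
  | zero => simp [state, State.init]
  | succ n ih =>
    have h4 := four_le_Ssq η g n
    have : 0 ≤ ‖η (n + 1) • g (n + 1)‖ ^ 2 /
      ((state η g n).Ssq + ‖η (n + 1) • g (n + 1)‖ ^ 2) := by positivity
    exact add_nonneg ih this

/-- Each increment `a / (A + a)` is at most `log ((A + a) / A)`, and these logarithms telescope. -/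
lemma state_Q_le (n : ℕ) : (state η g n).Q ≤ log ((state η g n).Ssq / 4) := by
  induction n with
  | zero => simp [state, State.init]
  | succ n ih =>
    have h4 := four_le_Ssq η g n
    simp only [state, State.step]
    set A := (state η g n).Ssq
    set a := ‖η (n + 1) • g (n + 1)‖ ^ 2
    have ha : 0 ≤ a := by positivity
    have hA : 0 < A := by linarith
    have h := one_sub_inv_le_log_of_pos (x := (A + a) / A) (by positivity)
    have e : log ((A + a) / 4) = log (A / 4) + log ((A + a) / A) := by
      rw [← log_mul (by positivity) (by positivity)]
      congr 1
      field_simp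
    have e' : 1 - ((A + a) / A)⁻¹ = a / (A + a) := by
      field_simp
      ring
    rw [e]
    linarith

variable (x₀ : EuclideanSpace ℝ (Fin d))

lemma state_succ (n : ℕ) :
    state η g (n + 1) = (state η g n).step (η (n + 1) • g (n + 1)) := rfl

lemma iterate_succ (n : ℕ) : iterate x₀ η g (n + 1) = (state η g n).output x₀ := rfl

lemma sum_inner_add_potential_le (hℓ : ∀ t, 1 ≤ t → ‖η t • g t‖ ≤ 1) (s k : ℕ) :
    (∑ t ∈ Finset.Ico (s + 1) (s + k + 1), inner ℝ (η t • g t) (iterate x₀ η g t - x₀)) +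
      (state η g (s + k)).potential (state η g (s + k)).θ ≤
      (state η g s).potential (state η g s).θ := by
  induction k with
  | zero => simp
  | succ n ih =>
    rw [← add_assoc, Finset.sum_Ico_succ_top (by omega)]
    have := (state η g (s + n)).potential_step_le x₀ (four_le_Ssq η g _) _
      (hℓ (s + n + 1) (by omega))
    rw [← state_succ, ← iterate_succ] at this
    linarith

/-- Each later round is undone by moving `v` by at most `‖ℓ‖ ^ 2`. This changes the linear term by
at most `‖u‖ ‖ℓ‖ ^ 2` and the potential costs a further `‖ℓ‖ ^ 2 / 4`. -/
lemma potential_tangent_later (s k : ℕ) (v : EuclideanSpace ℝ (Fin d)) :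
    (state η g s).potential (state η g s).θ +
      inner ℝ (iterate x₀ η g (s + 1) - x₀) (v - (state η g s).θ) ≤
    (state η g (s + k)).potential v +
      (‖iterate x₀ η g (s + 1) - x₀‖ + 1 / 4) *
        ∑ t ∈ Finset.Ico (s + 1) (s + k + 1), ‖η t • g t‖ ^ 2 := by
  induction k generalizing v with
  | zero =>
    simpa [iterate_succ] using (state η g s).potential_tangent x₀ (by linarith [four_le_Ssq η g s]) v
  | succ n ih =>
    rw [← add_assoc, Finset.sum_Ico_succ_top (by omega)]
    obtain ⟨v', h1, h2⟩ := (state η g (s + n)).exists_potential_le_step (four_le_Ssq η g _)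
      (state_Q_nonneg η g _) (η (s + n + 1) • g (s + n + 1)) v
    have h3 := ih v'
    set u := iterate x₀ η g (s + 1) - x₀
    have h4 : inner ℝ u (v - (state η g s).θ) =
        inner ℝ u (v' - (state η g s).θ) + inner ℝ u (v - v') := by
      rw [← inner_add_right]
      congr 1
      abel
    have h5 : inner ℝ u (v - v') ≤ ‖u‖ * ‖η (s + n + 1) • g (s + n + 1)‖ ^ 2 :=
      (real_inner_le_norm _ _).trans (by gcongr)
    rw [← state_succ] at h2
    rw [h4]
    linarith

/-- Regret of the rounds `s + 1, …, s + k` against the first iterate of these rounds. -/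
lemma sum_inner_sub_iterate_le (hℓ : ∀ t, 1 ≤ t → ‖η t • g t‖ ≤ 1) (s k : ℕ) :
    ∑ t ∈ Finset.Ico (s + 1) (s + k + 1),
      inner ℝ (η t • g t) (iterate x₀ η g t - iterate x₀ η g (s + 1)) ≤
      (‖iterate x₀ η g (s + 1) - x₀‖ + 1 / 4) *
        ∑ t ∈ Finset.Ico (s + 1) (s + k + 1), ‖η t • g t‖ ^ 2 := by
  have h1 := sum_inner_add_potential_le η g x₀ hℓ s k
  -- At `v = θ_{s+k}` the potential on the right is the one left over from telescoping in `h1`, so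
  -- the two cancel.
  have h2 := potential_tangent_later η g x₀ s k (state η g (s + k)).θ
  have h3 : (state η g (s + k)).θ - (state η g s).θ =
      -∑ t ∈ Finset.Ico (s + 1) (s + k + 1), η t • g t := by
    rw [state_θ, state_θ, ← Finset.sum_Ico_consecutive _ (by omega : 1 ≤ s + 1)
      (by omega : s + 1 ≤ s + k + 1)]
    abel
  rw [h3, inner_neg_right, inner_sum] at h2
  have h4 : ∑ t ∈ Finset.Ico (s + 1) (s + k + 1),
      inner ℝ (η t • g t) (iterate x₀ η g t - iterate x₀ η g (s + 1)) =
      (∑ t ∈ Finset.Ico (s + 1) (s + k + 1), inner ℝ (η t • g t) (iterate x₀ η g t - x₀)) -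
      ∑ t ∈ Finset.Ico (s + 1) (s + k + 1),
        inner ℝ (iterate x₀ η g (s + 1) - x₀) (η t • g t) := by
    rw [← Finset.sum_sub_distrib]
    refine Finset.sum_congr rfl fun t _ => ?_
    rw [real_inner_comm (η t • g t), ← inner_sub_right]
    congr 1
    abel
  linarith

/-- Fenchel-type inequality between an exponential and an entropy. -/
lemma mul_le_exp_add {K r D : ℝ} (hD : 0 ≤ D) :
    r * D ≤ exp (r / 2 - K) / 2 + 2 * D * (log (1 + 2 * D) + K + log 2) := by
  rcases hD.eq_or_lt with rfl | hD
  · simp only [mul_zero, zero_mul, add_zero]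
    positivity
  -- The tangent is taken at the maximizer of `r * D - exp (r / 2 - K) / 2`, where `exp (r / 2 - K)
  -- = 4 * D`.
  have h := add_one_le_exp (r / 2 - K - log (4 * D))
  rw [exp_sub, exp_log (by positivity), le_div_iff₀ (by positivity)] at h
  have h2 : log (4 * D) = log (2 * D) + log 2 := by
    rw [← log_mul (by positivity) (by positivity)]
    congr 1
    ring
  have h3 : log (2 * D) ≤ log (1 + 2 * D) := log_le_log (by positivity) (by linarith)
  rw [h2] at h
  have h4 := mul_le_mul_of_nonneg_left h3 hD.le
  nlinarith

lemma potential_ge {n : ℕ} {R : ℝ} (hR : (state η g n).Ssq ≤ R)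
    (v : EuclideanSpace ℝ (Fin d)) :
    exp (‖v‖ / 2 - (R / 4 + log (R / 4))) ≤ (state η g n).potential v := by
  have h4 := four_le_Ssq η g n
  have h1 := linear_le_huber (A := (state η g n).Ssq) (by linarith) ‖v‖
  have h2 := state_Q_le η g n
  have h3 : log ((state η g n).Ssq / 4) ≤ log (R / 4) :=
    log_le_log (by positivity) (by linarith)
  rw [State.potential, exp_le_exp]
  linarith

/-- Regret against a fixed point, with the next iterate controlled as well. -/
lemma norm_add_sum_inner_le (hℓ : ∀ t, 1 ≤ t → ‖η t • g t‖ ≤ 1) {n : ℕ} {R : ℝ}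
    (hR : (state η g n).Ssq ≤ R) (u : EuclideanSpace ℝ (Fin d)) :
    ‖iterate x₀ η g (n + 1) - x₀‖ +
      ∑ t ∈ Finset.Ico 1 (n + 1), inner ℝ (η t • g t) (iterate x₀ η g t - u) ≤
    1 + 2 * ‖u - x₀‖ * (log (1 + 2 * ‖u - x₀‖) + (R / 4 + log (R / 4)) + log 2) := by
  have h1 := sum_inner_add_potential_le η g x₀ hℓ 0 n
  have h0 : (state η g 0).potential (state η g 0).θ = 1 := by
    simp [state, State.init, State.potential, huber]
  rw [h0, zero_add, zero_add] at h1
  have h2 := (state η g n).norm_output_sub_le x₀ (by linarith [four_le_Ssq η g n])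
  have h3 := mul_le_exp_add (K := R / 4 + log (R / 4)) (r := ‖(state η g n).θ‖)
    (norm_nonneg (u - x₀))
  have h4 := potential_ge η g hR (state η g n).θ
  have h5 : inner ℝ (state η g n).θ (u - x₀) ≤ ‖(state η g n).θ‖ * ‖u - x₀‖ :=
    real_inner_le_norm _ _
  have h6 : ∑ t ∈ Finset.Ico 1 (n + 1), inner ℝ (η t • g t) (iterate x₀ η g t - u) =
      (∑ t ∈ Finset.Ico 1 (n + 1), inner ℝ (η t • g t) (iterate x₀ η g t - x₀)) +
      inner ℝ (state η g n).θ (u - x₀) := by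
    rw [state_θ, inner_neg_left, sum_inner, ← sub_eq_add_neg, ← Finset.sum_sub_distrib]
    refine Finset.sum_congr rfl fun t _ => ?_
    rw [← inner_sub_right]
    congr 1
    abel
  rw [← iterate_succ] at h2
  linarith

/-- A crude deterministic bound, needed only for integrability. -/
lemma norm_iterate_sub_le (hℓ : ∀ t, 1 ≤ t → ‖η t • g t‖ ≤ 1) (n : ℕ) :
    ‖iterate x₀ η g (n + 1) - x₀‖ ≤ exp (n / 2) := by
  have hA := four_le_Ssq η g n
  refine ((state η g n).norm_output_sub_le x₀ (by linarith)).trans ?_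
  have h1 : ‖(state η g n).θ‖ ≤ n := by
    rw [state_θ, norm_neg]
    refine (norm_sum_le _ _).trans ?_
    refine (Finset.sum_le_card_nsmul _ _ 1 fun t ht => hℓ t (Finset.mem_Ico.1 ht).1).trans ?_
    simp
  have h2 := huber_le_half (A := (state η g n).Ssq) (by linarith) (norm_nonneg (state η g n).θ)
  have h3 := state_Q_nonneg η g n
  have h4 : (state η g n).potential (state η g n).θ ≤ exp (n / 2) := by
    rw [State.potential]
    gcongr
    linarith
  linarith [exp_pos ((n : ℝ) / 2)]

end Path

/-! ### Power sums and the last-iterate conversion -/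

section Sums

lemma rpow_neg_le_telescope {β : ℝ} (hβ : 0 < β) {n : ℕ} (hn : 1 ≤ n) :
    ((n + 1 : ℕ) : ℝ) ^ (-(1 + β)) ≤ 1 / β * ((n : ℝ) ^ (-β) - ((n + 1 : ℕ) : ℝ) ^ (-β)) := by
  have hn0 : (0 : ℝ) < n := by exact_mod_cast hn
  have hm0 : (0 : ℝ) < ((n + 1 : ℕ) : ℝ) := by positivity
  set m : ℝ := ((n + 1 : ℕ) : ℝ) with hm
  have hmn : m = n + 1 := by simp [hm]
  have e1 : m ^ (-(1 + β)) = m ^ (-β) * (1 / m) := by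
    rw [neg_add, rpow_add hm0, rpow_neg_one]
    ring
  have hlog : 1 / m ≤ log (m / n) := by
    have := one_sub_inv_le_log_of_pos (x := m / n) (by positivity)
    have e : 1 - (m / n)⁻¹ = 1 / m := by
      rw [hmn]
      field_simp
      ring
    linarith
  have e2 : (n : ℝ) ^ (-β) = m ^ (-β) * exp (β * log (m / n)) := by
    rw [rpow_def_of_pos hn0, rpow_def_of_pos hm0, ← exp_add, log_div hm0.ne' hn0.ne']
    congr 1
    ring
  have h3 := add_one_le_exp (β * log (m / n))
  have h4 : β * (1 / m) ≤ exp (β * log (m / n)) - 1 := by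
    have := mul_le_mul_of_nonneg_left hlog hβ.le
    linarith
  have hp : 0 < m ^ (-β) := rpow_pos_of_pos hm0 _
  rw [e1, e2]
  calc m ^ (-β) * (1 / m) = 1 / β * (m ^ (-β) * (β * (1 / m))) := by field_simp
    _ ≤ 1 / β * (m ^ (-β) * (exp (β * log (m / n)) - 1)) := by gcongr
    _ = _ := by ring

lemma sum_rpow_le {β : ℝ} (hβ : 0 < β) (n : ℕ) :
    ∑ t ∈ Finset.Ico 1 (n + 1), (t : ℝ) ^ (-(1 + β)) ≤ 1 + 1 / β := by
  rcases Nat.eq_zero_or_pos n with rfl | hn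
  · simp
    positivity
  suffices h : ∑ t ∈ Finset.Ico 1 (n + 1), (t : ℝ) ^ (-(1 + β)) ≤
      1 + 1 / β * (1 - (n : ℝ) ^ (-β)) by
    have h1 : 0 ≤ (n : ℝ) ^ (-β) := by positivity
    have h2 : 0 < 1 / β := by positivity
    nlinarith
  induction n, hn using Nat.le_induction with
  | base => simp
  | succ n hn ih =>
    rw [Finset.sum_Ico_succ_top (by omega)]
    have := rpow_neg_le_telescope hβ hn
    linarith

/-- Keeping `-1 / (T + 1)` matters: the difference is `(T - s + 1) / (s (T + 1))`, whose numerator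
cancels a factor of the suffix weight in `mul_sum_weighted_tail_le`. -/
lemma sum_inv_sq_le {s : ℕ} (hs : 1 ≤ s) {T : ℕ} (hT : s ≤ T) :
    ∑ t ∈ Finset.Ico s (T + 1), 1 / (t : ℝ) ^ 2 ≤ 2 * (1 / s - 1 / (T + 1 : ℝ)) := by
  induction T, hT using Nat.le_induction with
  | base =>
    have hs0 : (1 : ℝ) ≤ s := by exact_mod_cast hs
    simp only [Finset.sum_Ico_succ_top le_rfl, Finset.Ico_self, Finset.sum_empty, zero_add]
    have : 2 * (1 / (s : ℝ) - 1 / (s + 1)) = 2 / (s * (s + 1)) := by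
      field_simp
      ring
    rw [this, div_le_div_iff₀ (by positivity) (by positivity)]
    nlinarith
  | succ T hT ih =>
    rw [Finset.sum_Ico_succ_top (by omega)]
    have : 1 / ((T + 1 : ℕ) : ℝ) ^ 2 ≤ 2 * (1 / (T + 1 : ℝ) - 1 / ((T + 1 : ℕ) + 1 : ℝ)) := by
      push_cast
      have : 2 * (1 / (T + 1 : ℝ) - 1 / (T + 1 + 1)) = 2 / ((T + 1) * (T + 2)) := by
        field_simp
        ring
      rw [this, div_le_div_iff₀ (by positivity) (by positivity)]
      have : (0 : ℝ) ≤ T := by positivity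
      nlinarith
    linarith

lemma sum_rpow_Ico_le {β : ℝ} (hβ1 : β ≤ 1) {s T : ℕ} (hs : 1 ≤ s)
    (hT : s ≤ T) :
    ∑ t ∈ Finset.Ico s (T + 1), (t : ℝ) ^ (-(1 + β)) ≤
      (T : ℝ) ^ (1 - β) * (2 * (1 / s - 1 / (T + 1 : ℝ))) := by
  refine le_trans ?_ (mul_le_mul_of_nonneg_left (sum_inv_sq_le hs hT) (by positivity))
  rw [Finset.mul_sum]
  refine Finset.sum_le_sum fun t ht => ?_
  obtain ⟨h1, h2⟩ := Finset.mem_Ico.1 ht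
  have ht0 : (0 : ℝ) < t := by exact_mod_cast (by omega : 0 < t)
  have htT : (t : ℝ) ≤ T := by exact_mod_cast (by omega : t ≤ T)
  have e : (t : ℝ) ^ (-(1 + β)) = (t : ℝ) ^ (1 - β) * (1 / (t : ℝ) ^ 2) := by
    rw [one_div, ← rpow_natCast, ← rpow_neg ht0.le, ← rpow_add ht0]
    congr 1
    push_cast
    ring
  rw [e]
  gcongr

lemma rpow_neg_mul_log_le {β : ℝ} (hβ : 0 < β) {T : ℕ} (hT : 1 ≤ T) :
    (T : ℝ) ^ (-β) * log T ≤ 1 / (exp 1 * β) := by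
  have hT0 : (0 : ℝ) < T := by exact_mod_cast hT
  have h := add_one_le_exp (β * log T - 1)
  have e : exp (β * log T - 1) = (T : ℝ) ^ β / exp 1 := by
    rw [exp_sub, rpow_def_of_pos hT0, mul_comm]
  have hp : 0 < (T : ℝ) ^ β := rpow_pos_of_pos hT0 _
  rw [e] at h
  rw [rpow_neg hT0.le, inv_mul_le_iff₀ hp]
  have h2 : β * log T ≤ (T : ℝ) ^ β / exp 1 := by linarith
  calc log T = 1 / β * (β * log T) := by field_simp
    _ ≤ 1 / β * ((T : ℝ) ^ β / exp 1) := by gcongr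
    _ = _ := by
      field_simp

lemma sum_one_div_add_le (T : ℕ) :
    ∑ s ∈ Finset.Ico 1 T, (1 / (s : ℝ) + 1 / ((T : ℝ) - s)) ≤ 2 * (1 + log T) := by
  have h1 : ∑ s ∈ Finset.Ico 1 T, 1 / (s : ℝ) ≤ 1 + log T := by
    refine le_trans ?_ (harmonic_le_one_add_log T)
    rw [harmonic_eq_sum_Icc]
    push_cast
    simp only [one_div]
    apply Finset.sum_le_sum_of_subset_of_nonneg
    · intro i hi
      rw [Finset.mem_Ico] at hi
      rw [Finset.mem_Icc]
      omega
    · intros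
      positivity
  have h2 : ∑ s ∈ Finset.Ico 1 T, 1 / ((T : ℝ) - s) = ∑ s ∈ Finset.Ico 1 T, 1 / (s : ℝ) := by
    have := Finset.sum_Ico_reflect (fun s : ℕ => 1 / (s : ℝ)) 1 (m := T) (n := T) (by omega)
    have e : Finset.Ico (T + 1 - T) (T + 1 - 1) = Finset.Ico 1 T := by grind
    rw [e] at this
    rw [← this]
    refine Finset.sum_congr rfl fun s hs => ?_
    rw [Nat.cast_sub (Finset.mem_Ico.1 hs).2.le]
  rw [Finset.sum_add_distrib, h2]
  linarith

/-- After that cancellation each term is at most a multiple of `T^(-β) (1 / s + 1 / (T - s))`. Two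
harmonic sums produce `log T`, which `T^(-β)` absorbs at cost `1 / (e β)`. -/
lemma mul_sum_weighted_tail_le {β : ℝ} (hβ : 0 < β) (hβ1 : β ≤ 1) {T : ℕ} (hT : 1 ≤ T) :
    T * ∑ s ∈ Finset.Ico 1 T, (∑ t ∈ Finset.Ico s (T + 1), (t : ℝ) ^ (-(1 + β))) /
      (((T : ℝ) - s) * ((T : ℝ) - s + 1)) ≤ 4 * (1 + 1 / (exp 1 * β)) := by
  have hT0 : (0 : ℝ) < T := by exact_mod_cast hT
  have hterm : ∀ s ∈ Finset.Ico 1 T, T * ((∑ t ∈ Finset.Ico s (T + 1), (t : ℝ) ^ (-(1 + β))) /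
      (((T : ℝ) - s) * ((T : ℝ) - s + 1))) ≤
      2 * (T : ℝ) ^ (-β) * (1 / (s : ℝ) + 1 / ((T : ℝ) - s)) := by
    intro s hs
    obtain ⟨h1, h2⟩ := Finset.mem_Ico.1 hs
    have hs0 : (0 : ℝ) < s := by exact_mod_cast h1
    have hsT : (0 : ℝ) < (T : ℝ) - s := sub_pos.2 (by exact_mod_cast h2)
    have hb := sum_rpow_Ico_le hβ1 h1 h2.le
    have e1 : (T : ℝ) ^ (1 - β) = T * (T : ℝ) ^ (-β) := by
      rw [sub_eq_add_neg, rpow_add hT0, rpow_one]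
    rw [e1] at hb
    have hp : 0 < (T : ℝ) ^ (-β) := rpow_pos_of_pos hT0 _
    calc _ ≤ T * ((T * (T : ℝ) ^ (-β) * (2 * (1 / s - 1 / (T + 1 : ℝ)))) /
          (((T : ℝ) - s) * ((T : ℝ) - s + 1))) := by gcongr
      _ = 2 * (T : ℝ) ^ (-β) * (T / (s * ((T : ℝ) - s))) * (T / (T + 1)) := by
          have : (T : ℝ) - s + 1 ≠ 0 := by positivity
          have h' : (1 / (s : ℝ) - 1 / (T + 1 : ℝ)) = (T - s + 1) / (s * (T + 1)) := by
            field_simp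
            ring
          rw [h']
          field_simp
      _ ≤ 2 * (T : ℝ) ^ (-β) * (T / (s * ((T : ℝ) - s))) * 1 := by
          gcongr
          rw [div_le_one (by positivity)]
          linarith
      _ = _ := by
          field_simp
          ring
  rw [Finset.mul_sum]
  refine (Finset.sum_le_sum hterm).trans ?_
  rw [← Finset.mul_sum]
  have h1 := sum_one_div_add_le T
  have h2 := rpow_neg_mul_log_le hβ hT
  have h3 : (T : ℝ) ^ (-β) ≤ 1 :=
    rpow_le_one_of_one_le_of_nonpos (by exact_mod_cast hT) (by linarith)
  calc _ ≤ 2 * (T : ℝ) ^ (-β) * (2 * (1 + log T)) := by gcongr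
    _ = 4 * ((T : ℝ) ^ (-β) + (T : ℝ) ^ (-β) * log T) := by ring
    _ ≤ _ := by gcongr

/-- Conversion of regret bounds into a bound on the last term. -/
lemma last_iterate_le {η q v : ℕ → ℝ} {T : ℕ} (hT : 1 ≤ T)
    (hη : ∀ s t, 1 ≤ s → s ≤ t → η t ≤ η s) (hq : ∀ t, 1 ≤ t → 0 ≤ q t)
    (hv : ∀ s ∈ Finset.Ico 1 T, ∑ t ∈ Finset.Ico s (T + 1), η t * (q t - q s) ≤ v s) :
    T * (η T * q T) ≤ ∑ t ∈ Finset.Ico 1 (T + 1), η t * q t +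
      T * ∑ s ∈ Finset.Ico 1 T, v s / (((T : ℝ) - s) * ((T : ℝ) - s + 1)) := by
  have hT0 : (0 : ℝ) < T := by exact_mod_cast hT
  -- The average over `s, …, T` is followed from `s = 1`, the full average, to `s = T`, the single
  -- last term.
  have key : ∀ s, 1 ≤ s → s ≤ T →
      (∑ t ∈ Finset.Ico s (T + 1), η t * q t) / ((T : ℝ) - s + 1) ≤
      (∑ t ∈ Finset.Ico 1 (T + 1), η t * q t) / T +
        ∑ j ∈ Finset.Ico 1 s, v j / (((T : ℝ) - j) * ((T : ℝ) - j + 1)) := by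
    intro s hs
    induction s, hs using Nat.le_induction with
    | base => simp
    | succ s hs ih =>
      intro hsT
      have ih := ih (by omega)
      rw [Finset.sum_Ico_succ_top hs]
      have hk : (0 : ℝ) < (T : ℝ) - s := sub_pos.2 (by exact_mod_cast hsT)
      have hvs := hv s (Finset.mem_Ico.2 ⟨hs, hsT⟩)
      have hsplit := Finset.sum_eq_sum_Ico_succ_bot (by omega : s < T + 1) (fun t => η t * q t)
      -- Replacing `η t * q s` by the larger `η s * q s` uses that `η` decreases and `q s ≥ 0`.
      have hlow : ∑ t ∈ Finset.Ico s (T + 1), η t * q t - ((T : ℝ) - s + 1) * (η s * q s) ≤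
          ∑ t ∈ Finset.Ico s (T + 1), η t * (q t - q s) := by
        have hc : ∑ t ∈ Finset.Ico s (T + 1), η s * q s = ((T : ℝ) - s + 1) * (η s * q s) := by
          rw [Finset.sum_const, Nat.card_Ico, nsmul_eq_mul, Nat.cast_sub (by omega)]
          push_cast
          ring
        rw [← hc, ← Finset.sum_sub_distrib]
        refine Finset.sum_le_sum fun t ht => ?_
        have := mul_le_mul_of_nonneg_right (hη s t hs (Finset.mem_Ico.1 ht).1) (hq s hs)
        linarith
      set A := ∑ t ∈ Finset.Ico s (T + 1), η t * q t
      set B := ∑ t ∈ Finset.Ico (s + 1) (T + 1), η t * q t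
      have hc : (T : ℝ) - (s + 1 : ℕ) + 1 = T - s := by
        push_cast
        ring
      rw [hc]
      have : B / ((T : ℝ) - s) ≤
          A / ((T : ℝ) - s + 1) + v s / (((T : ℝ) - s) * ((T : ℝ) - s + 1)) := by
        have e : A / ((T : ℝ) - s + 1) + v s / (((T : ℝ) - s) * ((T : ℝ) - s + 1)) =
            ((((T : ℝ) - s) * A + v s) / ((T : ℝ) - s + 1)) / ((T : ℝ) - s) := by
          have : (T : ℝ) - s + 1 ≠ 0 := by positivity
          field_simp
        rw [e]
        gcongr
        rw [le_div_iff₀ (by positivity)]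
        nlinarith
      linarith
  have h := key T hT le_rfl
  rw [Finset.sum_Ico_succ_top le_rfl, Finset.Ico_self, Finset.sum_empty, sub_self, zero_add,
    zero_add, div_one] at h
  calc T * (η T * q T) ≤ T * _ := mul_le_mul_of_nonneg_left h hT0.le
    _ = _ := by
      rw [mul_add]
      congr 1
      field_simp

end Sums

/-! ### Gradient inequality and conditional expectation -/

section Convex

variable {E : Type*} [NormedAddCommGroup E] [InnerProductSpace ℝ E] [CompleteSpace E]

/-- On the line from `x` to `y`, the slope of a convex function over `[0, 1]` is at least its
derivative at `0`. -/
lemma _root_.ConvexOn.sub_le_inner_gradient {F : E → ℝ} (hconv : ConvexOn ℝ Set.univ F) {x : E}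
    (hdiff : DifferentiableAt ℝ F x) (y : E) :
    F x - F y ≤ inner ℝ (gradient F x) (x - y) := by
  have hline : ConvexOn ℝ Set.univ (F ∘ AffineMap.lineMap (k := ℝ) x y) := by
    simpa using hconv.comp_affineMap (AffineMap.lineMap (k := ℝ) x y)
  have hd : HasDerivAt (F ∘ AffineMap.lineMap (k := ℝ) x y) (inner ℝ (gradient F x) (y - x)) 0 := by
    have h1 : HasDerivAt (AffineMap.lineMap (k := ℝ) x y) (y - x) 0 :=
      AffineMap.hasDerivAt_lineMap
    have h2 : HasFDerivAt F (InnerProductSpace.toDual ℝ E (gradient F x))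
        (AffineMap.lineMap (k := ℝ) x y 0) := by
      simpa using hdiff.hasGradientAt.hasFDerivAt
    simpa using h2.comp_hasDerivAt 0 h1
  have h := hline.le_slope_of_hasDerivAt (Set.mem_univ 0) (Set.mem_univ 1) zero_lt_one hd
  simp only [slope, Function.comp, AffineMap.lineMap_apply_zero, AffineMap.lineMap_apply_one,
    vsub_eq_sub, sub_zero, inv_one, one_smul] at h
  rw [← neg_sub y x, inner_neg_right]
  linarith

/-- A stochastic gradient gives, in expectation, an upper bound on the suboptimality. -/
lemma integral_sub_le_integral_inner {Ω : Type*} {m mΩ : MeasurableSpace Ω} {μ : Measure Ω}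
    [IsProbabilityMeasure μ] (hm : m ≤ mΩ) {F : E → ℝ} (hconv : ConvexOn ℝ Set.univ F)
    (hdiff : Differentiable ℝ F) {x y g : Ω → E} (hx : StronglyMeasurable[m] x)
    (hy : StronglyMeasurable[m] y) {R : ℝ} (hR : ∀ᵐ ω ∂μ, ‖x ω - y ω‖ ≤ R)
    (hg : Integrable g μ) (hgrad : μ[g | m] =ᵐ[μ] fun ω => gradient F (x ω))
    (hFx : Integrable (fun ω => F (x ω)) μ) (hFy : Integrable (fun ω => F (y ω)) μ) :
    (∫ ω, F (x ω) ∂μ) - ∫ ω, F (y ω) ∂μ ≤ ∫ ω, inner ℝ (g ω) (x ω - y ω) ∂μ := by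
  have hxy : StronglyMeasurable[m] fun ω => x ω - y ω := hx.sub hy
  have hint : ∀ f : Ω → E, Integrable f μ →
      Integrable (fun ω => innerSL ℝ (f ω) (x ω - y ω)) μ := fun f hf =>
    (innerSL ℝ).integrable_of_bilin_of_bdd_right R hf (hxy.mono hm).aestronglyMeasurable hR
  have hpull := condExp_bilin_of_stronglyMeasurable_right (innerSL ℝ) hxy (hint g hg) hg
  rw [← integral_sub hFx hFy]
  have h1 : ∫ ω, inner ℝ (g ω) (x ω - y ω) ∂μ = ∫ ω, inner ℝ (μ[g | m] ω) (x ω - y ω) ∂μ := by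
    have := integral_condExp (μ := μ) hm (f := fun ω => innerSL ℝ (g ω) (x ω - y ω))
    rw [integral_congr_ae hpull] at this
    exact this.symm
  rw [h1]
  refine integral_mono_ae (hFx.sub hFy) (hint _ integrable_condExp) ?_
  filter_upwards [hgrad] with ω hω
  simp only [hω]
  exact hconv.sub_le_inner_gradient (hdiff _) _

end Convex

/-! ### Measurability of the iterates and histories -/

section Measurability

variable {Ω : Type*} [MeasurableSpace Ω] {d : ℕ}

lemma measurable_state {η : ℕ → ℝ} {g : ℕ → Ω → EuclideanSpace ℝ (Fin d)}
    (hg : ∀ t, 1 ≤ t → Measurable (g t)) (n : ℕ) :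
    Measurable (fun ω => (state η (fun s => g s ω) n).θ) ∧
    Measurable (fun ω => (state η (fun s => g s ω) n).Ssq) ∧
    Measurable (fun ω => (state η (fun s => g s ω) n).Q) := by
  induction n with
  | zero => simp [state, State.init]
  | succ n ih =>
    obtain ⟨h1, h2, h3⟩ := ih
    have hgn := hg (n + 1) (by omega)
    simp only [state, State.step]
    refine ⟨?_, ?_, ?_⟩ <;> fun_prop

lemma measurable_iterate {η : ℕ → ℝ} {g : ℕ → Ω → EuclideanSpace ℝ (Fin d)}
    (hg : ∀ t, 1 ≤ t → Measurable (g t)) (x₀ : EuclideanSpace ℝ (Fin d)) (n : ℕ) :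
    Measurable (fun ω => iterate x₀ η (fun s => g s ω) n) := by
  cases n with
  | zero => simp [iterate]
  | succ n =>
    obtain ⟨h1, h2, h3⟩ := measurable_state (η := η) hg n
    simp only [iterate, State.output]
    refine measurable_const.add (Measurable.ite (measurableSet_le h1.norm h2) ?_ ?_) <;> fun_prop

lemma history_le {x g : ℕ → Ω → EuclideanSpace ℝ (Fin d)} (hx : ∀ t, 1 ≤ t → Measurable (x t))
    (hg : ∀ t, 1 ≤ t → Measurable (g t)) (t : ℕ) : history x g t ≤ ‹MeasurableSpace Ω› :=
  sup_le (iSup₂_le fun i hi => (hx i hi.1).comap_le) (iSup₂_le fun i hi => (hg i hi.1).comap_le)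

end Measurability

lemma measurable_history {Ω : Type*} {d : ℕ} {x g : ℕ → Ω → EuclideanSpace ℝ (Fin d)} {s t : ℕ} (hs : 1 ≤ s)
    (hst : s ≤ t) : Measurable[history x g t] (x s) := by
  refine (comap_measurable (x s)).mono ?_ le_rfl
  exact le_sup_of_le_left
    (le_iSup₂_of_le (f := fun i (_ : i ∈ Set.Icc 1 t) => MeasurableSpace.comap (x i) inferInstance)
      s ⟨hs, hst⟩ le_rfl)

lemma norm_rescaled_le {E : Type*} [NormedAddCommGroup E] [NormedSpace ℝ E] {G α : ℝ} (hG : 0 < G)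
    {t : ℕ} (ht : 1 ≤ t) {v : E} (hv : ‖v‖ ≤ G) :
    ‖(1 / (G * (t : ℝ) ^ α)) • v‖ ≤ (t : ℝ) ^ (-α) := by
  have ht0 : (0 : ℝ) < t := by exact_mod_cast ht
  have hp : 0 < (t : ℝ) ^ α := rpow_pos_of_pos ht0 _
  rw [norm_smul, Real.norm_eq_abs, abs_of_nonneg (by positivity), rpow_neg ht0.le]
  calc 1 / (G * (t : ℝ) ^ α) * ‖v‖ ≤ 1 / (G * (t : ℝ) ^ α) * G := by gcongr
    _ = _ := by field_simp

/-- The regret constant is at most the corresponding part of the rate. -/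
lemma regret_const_le {D S R : ℝ} (hD : 0 ≤ D) (hS : 0 ≤ S) (hR : S ^ 2 = R) (hR4 : 4 ≤ R) :
    2 * (1 + 2 * D * (log (1 + 2 * D) + (R / 4 + log (R / 4)) + log 2)) ≤
      2 + S * D * (2 * log (1 + 2 * D) + 9 * S) := by
  have hS2 : 2 ≤ S := by nlinarith
  have hL : 0 ≤ log (1 + 2 * D) := log_nonneg (by linarith)
  have h1 : log (R / 4) + log 2 ≤ R / 2 := by
    rw [← log_mul (by positivity) (by positivity)]
    have := log_le_sub_one_of_pos (x := R / 4 * 2) (by positivity)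
    linarith
  have h2 : D * (log (R / 4) + log 2) ≤ D * (R / 2) := by gcongr
  have h3 : 2 * (D * log (1 + 2 * D)) ≤ S * (D * log (1 + 2 * D)) := by gcongr
  have h4 : 0 ≤ D * R := by positivity
  have e : S * D * (2 * log (1 + 2 * D) + 9 * S) =
      2 * (S * (D * log (1 + 2 * D))) + 9 * (D * R) := by
    rw [← hR]
    ring
  rw [e]
  linarith

/-! ### Boundedness and integrability along the random iterates -/

section Stochastic

variable {d : ℕ} {Ω : Type*} [MeasurableSpace Ω] {μ : Measure Ω}
  {F : EuclideanSpace ℝ (Fin d) → ℝ} {α G : ℝ} {x₀ : EuclideanSpace ℝ (Fin d)}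
  {g x : ℕ → Ω → EuclideanSpace ℝ (Fin d)}

lemma exists_ae_norm_iterate_sub_le (hα : 0 ≤ α) (hG : 0 < G)
    (hx : ∀ t, 1 ≤ t → ∀ ω,
      x t ω = iterate x₀ (fun s => 1 / (G * (s : ℝ) ^ α)) (fun s => g s ω) t)
    (hg_bound : ∀ t, 1 ≤ t → ∀ᵐ ω ∂μ, ‖g t ω‖ ≤ G) {t : ℕ} (ht : 1 ≤ t) :
    ∃ R : ℝ, ∀ᵐ ω ∂μ, ‖x t ω - x₀‖ ≤ R := by
  obtain ⟨n, rfl⟩ : ∃ n, t = n + 1 := ⟨t - 1, by omega⟩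
  refine ⟨exp (n / 2), ?_⟩
  have hall : ∀ᵐ ω ∂μ, ∀ t, 1 ≤ t → ‖g t ω‖ ≤ G :=
    ae_all_iff.2 fun t => Filter.eventually_imp_distrib_left.2 (hg_bound t)
  filter_upwards [hall] with ω hω
  rw [hx _ ht ω]
  refine norm_iterate_sub_le _ _ _ (fun t ht => (norm_rescaled_le hG ht (hω t ht)).trans ?_) n
  exact rpow_le_one_of_one_le_of_nonpos (by exact_mod_cast ht) (by linarith)

lemma integrable_comp_of_ae_norm_sub_le [IsFiniteMeasure μ] (hF : Continuous F) {y : Ω → EuclideanSpace ℝ (Fin d)}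
    (hy : Measurable y) {R : ℝ} (hR : ∀ᵐ ω ∂μ, ‖y ω - x₀‖ ≤ R) :
    Integrable (fun ω => F (y ω)) μ := by
  obtain ⟨C, hC⟩ := (isCompact_closedBall x₀ R).exists_bound_of_continuousOn hF.continuousOn
  refine Integrable.of_bound (hF.measurable.comp hy).aestronglyMeasurable C ?_
  filter_upwards [hR] with ω hω
  exact hC _ (mem_closedBall_iff_norm.2 hω)

end Stochastic

end FTRL

theorem theorem3 {d : ℕ} {Ω : Type*} [MeasurableSpace Ω] (μ : Measure Ω) [IsProbabilityMeasure μ]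
    (F : EuclideanSpace ℝ (Fin d) → ℝ)
    (hconv : ConvexOn ℝ Set.univ F) (hdiff : Differentiable ℝ F)
    (xstar : EuclideanSpace ℝ (Fin d)) (hmin : ∀ y, F xstar ≤ F y)
    (α : ℝ) (hα : α ∈ Set.Ioo (1 / 2 : ℝ) 1)
    (G : ℝ) (hG : 0 < G)
    (x₀ : EuclideanSpace ℝ (Fin d))
    (g x : ℕ → Ω → EuclideanSpace ℝ (Fin d))
    (hg_meas : ∀ t, 1 ≤ t → Measurable (g t))
    (hx : ∀ t, 1 ≤ t → ∀ ω,
      x t ω = FTRL.iterate x₀ (fun s => 1 / (G * (s : ℝ) ^ α)) (fun s => g s ω) t)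
    (hg_grad : ∀ t, 1 ≤ t → μ[g t | FTRL.history x g t] =ᵐ[μ] fun ω => gradient F (x t ω))
    (hg_bound : ∀ t, 1 ≤ t → ∀ᵐ ω ∂μ, ‖g t ω‖ ≤ G)
    (S : ℝ) (hS : S = Real.sqrt (5 + 1 / (2 * α - 1)))
    (T : ℕ) (hT : 1 ≤ T) :
    Integrable (fun ω => F (x T ω)) μ ∧
    (∫ ω, F (x T ω) ∂μ) - F xstar ≤
      G / (T : ℝ) ^ (1 - α) * (2 + 1 / (Real.exp 1 * (2 * α - 1))) *
        (Real.exp S + 3 * ‖xstar - x₀‖ +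
          6 * (S + 2) * (2 + S * ‖xstar - x₀‖ *
            (2 * Real.log (1 + 2 * ‖xstar - x₀‖) + 9 * S))) := by
  obtain ⟨hα0, hα1⟩ := hα
  -- With this `β`, `‖ℓ_t‖ ^ 2 ≤ t^(-2α) = t^(-(1 + β))`, so `S_t² ≤ 4 + 1 + 1 / β = S²`.
  set β := 2 * α - 1 with hβ_def
  have hβ : 0 < β := by linarith
  have hβ1 : β ≤ 1 := by linarith
  have hxm : ∀ t, 1 ≤ t → Measurable (x t) := fun t ht => by
    rw [funext (hx t ht)]
    exact FTRL.measurable_iterate hg_meas x₀ t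
  have hxb : ∀ t, 1 ≤ t → ∃ R : ℝ, ∀ᵐ ω ∂μ, ‖x t ω - x₀‖ ≤ R := fun t ht =>
    FTRL.exists_ae_norm_iterate_sub_le (by linarith) hG hx hg_bound ht
  have hFint : ∀ t, 1 ≤ t → Integrable (fun ω => F (x t ω)) μ := fun t ht => by
    obtain ⟨R, hR⟩ := hxb t ht
    exact FTRL.integrable_comp_of_ae_norm_sub_le hdiff.continuous (hxm t ht) hR
  refine ⟨hFint T hT, ?_⟩
  have hall : ∀ᵐ ω ∂μ, ∀ t, 1 ≤ t → ‖g t ω‖ ≤ G :=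
    ae_all_iff.2 fun t => Filter.eventually_imp_distrib_left.2 (hg_bound t)
  have hgint : ∀ t, 1 ≤ t → Integrable (g t) μ := fun t ht =>
    Integrable.of_bound (hg_meas t ht).aestronglyMeasurable G (hg_bound t ht)
  set η : ℕ → ℝ := fun s => 1 / (G * (s : ℝ) ^ α) with hη_def
  have hη0 : ∀ t, 0 ≤ η t := fun t => by positivity
  -- Pathwise bounds on the rescaled gradients.
  have hℓ : ∀ᵐ ω ∂μ, ∀ t, 1 ≤ t → ‖η t • g t ω‖ ≤ 1 ∧
      ‖η t • g t ω‖ ^ 2 ≤ (t : ℝ) ^ (-(1 + β)) := by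
    filter_upwards [hall] with ω hω t ht
    have h := FTRL.norm_rescaled_le (α := α) hG ht (hω t ht)
    have ht1 : (1 : ℝ) ≤ t := by exact_mod_cast ht
    refine ⟨h.trans (Real.rpow_le_one_of_one_le_of_nonpos ht1 (by linarith)), ?_⟩
    have e : (t : ℝ) ^ (-(1 + β)) = ((t : ℝ) ^ (-α)) ^ 2 := by
      rw [← Real.rpow_natCast, ← Real.rpow_mul (by linarith)]
      congr 1
      rw [hβ_def]
      push_cast
      ring
    rw [e]
    gcongr
  have hinner_int : ∀ t, 1 ≤ t → ∀ y : Ω → EuclideanSpace ℝ (Fin d), Measurable y →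
      (∃ R : ℝ, ∀ᵐ ω ∂μ, ‖y ω - x₀‖ ≤ R) →
      Integrable (fun ω => inner ℝ (η t • g t ω) (x t ω - y ω)) μ := by
    intro t ht y hy ⟨R, hR⟩
    obtain ⟨R', hR'⟩ := hxb t ht
    refine (innerSL ℝ).integrable_of_bilin_of_bdd_right (R' + R) ((hgint t ht).smul (η t))
      ((hxm t ht).sub hy).aestronglyMeasurable ?_
    filter_upwards [hR, hR'] with ω h1 h2
    have : x t ω - y ω = (x t ω - x₀) - (y ω - x₀) := by abel
    rw [this]
    exact (norm_sub_le _ _).trans (add_le_add h2 h1)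
  -- The comparator `y` may be random as long as it is known at time `t`; this admits earlier
  -- iterates as well as `xstar`.
  have hgrad_le : ∀ t, 1 ≤ t → ∀ y : Ω → EuclideanSpace ℝ (Fin d),
      Measurable[FTRL.history x g t] y → (∃ R : ℝ, ∀ᵐ ω ∂μ, ‖y ω - x₀‖ ≤ R) →
      η t * ((∫ ω, F (x t ω) ∂μ) - ∫ ω, F (y ω) ∂μ) ≤
        ∫ ω, inner ℝ (η t • g t ω) (x t ω - y ω) ∂μ := by
    intro t ht y hy ⟨R, hR⟩
    obtain ⟨R', hR'⟩ := hxb t ht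
    have hm := FTRL.history_le hxm hg_meas t
    have hb : ∀ᵐ ω ∂μ, ‖x t ω - y ω‖ ≤ R' + R := by
      filter_upwards [hR, hR'] with ω h1 h2
      have : x t ω - y ω = (x t ω - x₀) - (y ω - x₀) := by abel
      rw [this]
      exact (norm_sub_le _ _).trans (add_le_add h2 h1)
    have h := FTRL.integral_sub_le_integral_inner hm hconv hdiff
      (FTRL.measurable_history ht le_rfl).stronglyMeasurable hy.stronglyMeasurable hb (hgint t ht)
      (hg_grad t ht) (hFint t ht)
      (FTRL.integrable_comp_of_ae_norm_sub_le hdiff.continuous (hy.mono hm le_rfl) hR)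
    simp only [inner_smul_left, conj_trivial]
    rw [integral_const_mul]
    exact mul_le_mul_of_nonneg_left h (hη0 t)
  have hconst : ∃ R : ℝ, ∀ᵐ _ω ∂μ, ‖xstar - x₀‖ ≤ R := ⟨_, ae_of_all _ fun _ => le_rfl⟩
  set q : ℕ → ℝ := fun t => (∫ ω, F (x t ω) ∂μ) - F xstar with hq_def
  have hq : ∀ t, 1 ≤ t → 0 ≤ q t := by
    intro t ht
    have h : ∫ _ω, F xstar ∂μ ≤ ∫ ω, F (x t ω) ∂μ :=
      integral_mono (integrable_const _) (hFint t ht) fun ω => hmin _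
    simp only [integral_const, probReal_univ, one_smul] at h
    exact sub_nonneg.2 h
  have hqη : ∀ t, 1 ≤ t → η t * q t ≤ ∫ ω, inner ℝ (η t • g t ω) (x t ω - xstar) ∂μ := by
    intro t ht
    have h := hgrad_le t ht (fun _ => xstar) measurable_const hconst
    simpa only [integral_const, probReal_univ, one_smul] using h
  set D := ‖xstar - x₀‖ with hD
  set R := 5 + 1 / β with hR
  have hR5 : 5 ≤ R := by
    have : 0 < 1 / β := by positivity
    linarith
  have hS0 : 0 ≤ S := hS ▸ Real.sqrt_nonneg _
  have hSR : S ^ 2 = R := by rw [hS, Real.sq_sqrt (by linarith)]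
  set C := 1 + 2 * D * (Real.log (1 + 2 * D) + (R / 4 + Real.log (R / 4)) + Real.log 2) with hC
  have hCM := FTRL.regret_const_le (norm_nonneg (xstar - x₀)) hS0 hSR (by linarith)
  rw [← hD, ← hC] at hCM
  set M := 2 + S * D * (2 * Real.log (1 + 2 * D) + 9 * S) with hM
  have hregret : ∀ n : ℕ, (∫ ω, ‖x (n + 1) ω - x₀‖ ∂μ) +
      ∑ t ∈ Finset.Ico 1 (n + 1), η t * q t ≤ C := by
    intro n
    have hxn : Integrable (fun ω => ‖x (n + 1) ω - x₀‖) μ := by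
      obtain ⟨R', hR'⟩ := hxb (n + 1) (by omega)
      exact (Integrable.of_bound ((hxm _ (by omega)).sub_const x₀).aestronglyMeasurable R' hR').norm
    have hsint : ∀ t ∈ Finset.Ico 1 (n + 1),
        Integrable (fun ω => inner ℝ (η t • g t ω) (x t ω - xstar)) μ := fun t ht =>
      hinner_int t (Finset.mem_Ico.1 ht).1 (fun _ => xstar) measurable_const hconst
    calc _ ≤ (∫ ω, ‖x (n + 1) ω - x₀‖ ∂μ) +
          ∑ t ∈ Finset.Ico 1 (n + 1), ∫ ω, inner ℝ (η t • g t ω) (x t ω - xstar) ∂μ := by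
          gcongr with t ht
          exact hqη t (Finset.mem_Ico.1 ht).1
      _ = ∫ ω, (‖x (n + 1) ω - x₀‖ +
          ∑ t ∈ Finset.Ico 1 (n + 1), inner ℝ (η t • g t ω) (x t ω - xstar)) ∂μ := by
          rw [integral_add hxn (integrable_finsetSum _ hsint), integral_finsetSum _ hsint]
      _ ≤ ∫ _ω, C ∂μ := by
          refine integral_mono_ae (hxn.add (integrable_finsetSum _ hsint))
            (integrable_const _) ?_
          filter_upwards [hℓ] with ω hω
          have hSsq : (FTRL.state η (fun s => g s ω) n).Ssq ≤ R := by
            rw [FTRL.state_Ssq, hR]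
            have : ∑ t ∈ Finset.Ico 1 (n + 1), ‖η t • g t ω‖ ^ 2 ≤ 1 + 1 / β :=
              (Finset.sum_le_sum fun t ht => (hω t (Finset.mem_Ico.1 ht).1).2).trans
                (FTRL.sum_rpow_le hβ n)
            linarith
          have h := FTRL.norm_add_sum_inner_le η (fun s => g s ω) x₀ (fun t ht => (hω t ht).1)
            hSsq xstar
          rw [← hx (n + 1) (by omega) ω] at h
          refine le_trans (le_of_eq ?_) h
          congr 1
          refine Finset.sum_congr rfl fun t ht => ?_
          rw [hx t (Finset.mem_Ico.1 ht).1 ω]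
      _ = C := by simp
  have hsum_nonneg : ∀ n : ℕ, 0 ≤ ∑ t ∈ Finset.Ico 1 (n + 1), η t * q t := fun n =>
    Finset.sum_nonneg fun t ht => mul_nonneg (hη0 t) (hq t (Finset.mem_Ico.1 ht).1)
  have hv : ∀ s ∈ Finset.Ico 1 T, ∑ t ∈ Finset.Ico s (T + 1), η t * (q t - q s) ≤
      (M / 2 + 1 / 4) * ∑ t ∈ Finset.Ico s (T + 1), (t : ℝ) ^ (-(1 + β)) := by
    intro s hs
    obtain ⟨hs1, hsT⟩ := Finset.mem_Ico.1 hs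
    obtain ⟨m, rfl⟩ : ∃ m, s = m + 1 := ⟨s - 1, by omega⟩
    obtain ⟨k, rfl⟩ : ∃ k, T = m + k := ⟨T - m, by omega⟩
    have hxs : Integrable (fun ω => ‖x (m + 1) ω - x₀‖) μ := by
      obtain ⟨R', hR'⟩ := hxb (m + 1) hs1
      exact (Integrable.of_bound ((hxm _ hs1).sub_const x₀).aestronglyMeasurable R' hR').norm
    have hsint : ∀ t ∈ Finset.Ico (m + 1) (m + k + 1),
        Integrable (fun ω => inner ℝ (η t • g t ω) (x t ω - x (m + 1) ω)) μ := fun t ht =>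
      hinner_int t (hs1.trans (Finset.mem_Ico.1 ht).1) _ (hxm _ hs1) (hxb _ hs1)
    set W := ∑ t ∈ Finset.Ico (m + 1) (m + k + 1), (t : ℝ) ^ (-(1 + β)) with hW
    have hW0 : 0 ≤ W := Finset.sum_nonneg fun t _ => by positivity
    calc _ ≤ ∑ t ∈ Finset.Ico (m + 1) (m + k + 1),
          ∫ ω, inner ℝ (η t • g t ω) (x t ω - x (m + 1) ω) ∂μ := by
          refine Finset.sum_le_sum fun t ht => ?_
          have hmt := (Finset.mem_Ico.1 ht).1
          have h := hgrad_le t (hs1.trans hmt) (x (m + 1)) (FTRL.measurable_history hs1 hmt)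
            (hxb _ hs1)
          rwa [hq_def, sub_sub_sub_cancel_right]
      _ = ∫ ω, ∑ t ∈ Finset.Ico (m + 1) (m + k + 1),
          inner ℝ (η t • g t ω) (x t ω - x (m + 1) ω) ∂μ := (integral_finsetSum _ hsint).symm
      _ ≤ ∫ ω, (‖x (m + 1) ω - x₀‖ + 1 / 4) * W ∂μ := by
          refine integral_mono_ae (integrable_finsetSum _ hsint)
            ((hxs.add (integrable_const _)).mul_const W) ?_
          filter_upwards [hℓ] with ω hω
          have h := FTRL.sum_inner_sub_iterate_le η (fun s => g s ω) x₀ (fun t ht => (hω t ht).1)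
            m k
          rw [← hx (m + 1) hs1 ω] at h
          have h2 : ∑ t ∈ Finset.Ico (m + 1) (m + k + 1), ‖η t • g t ω‖ ^ 2 ≤ W :=
            Finset.sum_le_sum fun t ht => (hω t (hs1.trans (Finset.mem_Ico.1 ht).1)).2
          refine le_trans (le_of_eq ?_) (h.trans (mul_le_mul_of_nonneg_left h2 (by positivity)))
          refine Finset.sum_congr rfl fun t ht => ?_
          rw [hx t (hs1.trans (Finset.mem_Ico.1 ht).1) ω]
      _ = ((∫ ω, ‖x (m + 1) ω - x₀‖ ∂μ) + 1 / 4) * W := by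
          rw [integral_mul_const, integral_add hxs (integrable_const _)]
          simp
      _ ≤ (M / 2 + 1 / 4) * W := by
          gcongr
          linarith [hregret m, hsum_nonneg m]
  have hηanti : ∀ s t, 1 ≤ s → s ≤ t → η t ≤ η s := by
    intro s t hs hst
    have hs0 : (0 : ℝ) < s := by exact_mod_cast hs
    have hst' : (s : ℝ) ≤ t := by exact_mod_cast hst
    simp only [hη_def]
    gcongr
  have hlast := FTRL.last_iterate_le hT hηanti hq hv
  have hweights := FTRL.mul_sum_weighted_tail_le hβ hβ1 hT
  set P := 2 + 1 / (Real.exp 1 * β) with hP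
  have hP2 : 2 ≤ P := by
    have : 0 < 1 / (Real.exp 1 * β) := by positivity
    linarith
  have hD0 : 0 ≤ D := norm_nonneg _
  have hM2 : 2 ≤ M := by
    have : 0 ≤ Real.log (1 + 2 * D) := Real.log_nonneg (by linarith)
    have : 0 ≤ S * D * (2 * Real.log (1 + 2 * D) + 9 * S) := by positivity
    linarith
  have hTpos : (0 : ℝ) < T := by exact_mod_cast hT
  have hfirst : ∑ t ∈ Finset.Ico 1 (T + 1), η t * q t ≤ M := by
    have h0 : 0 ≤ ∫ ω, ‖x (T + 1) ω - x₀‖ ∂μ := integral_nonneg fun ω => norm_nonneg _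
    linarith [hregret T]
  simp only [mul_div_assoc] at hlast
  rw [← Finset.mul_sum, mul_left_comm] at hlast
  have hsecond := mul_le_mul_of_nonneg_left hweights (by linarith : 0 ≤ M / 2 + 1 / 4)
  -- The bounds collected give `M + (M / 2 + 1 / 4) * 4 * (P - 1)`; the term `12 * P * M` alone
  -- exceeds this, so `exp S` and `3 * D` are slack.
  have htotal : T * (η T * q T) ≤ P * (Real.exp S + 3 * D + 6 * (S + 2) * M) := by
    have hMP : 0 ≤ (M - 2) * (P - 2) := mul_nonneg (by linarith) (by linarith)
    have hPM : 0 ≤ P * M := by positivity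
    have h1 : 0 ≤ P * (Real.exp S + 3 * D + 6 * S * M) := by positivity
    have h2 : 1 + 1 / (Real.exp 1 * β) = P - 1 := by
      rw [hP]
      ring
    rw [h2] at hsecond
    nlinarith
  have hηT : T * η T = (T : ℝ) ^ (1 - α) / G := by
    rw [hη_def, Real.rpow_sub hTpos, Real.rpow_one]
    field_simp
  have hpow : 0 < (T : ℝ) ^ (1 - α) := Real.rpow_pos_of_pos hTpos _
  calc q T = G / (T : ℝ) ^ (1 - α) * (T * (η T * q T)) := by
        rw [← mul_assoc (T : ℝ), hηT]
        field_simp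
    _ ≤ G / (T : ℝ) ^ (1 - α) * (P * (Real.exp S + 3 * D + 6 * (S + 2) * M)) := by gcongr
    _ = _ := by ring
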